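/- Let $G$ and $H$ be finitely generated groups, and let $(\Omega,m)$ be an integrable measure coupling (IME coupling) of $G$ and $H$. That is, $(\Omega,m)$ is a nonzero $\sigma$-finite measure space with commuting measurable $m$-preserving actions of $G$ and $H$, together with a finite-measure fundamental domain $X$ for the action of $H$ and a finite-measure fundamental domain $Y$ for the action of $G$, such that the following associated cocycles are integrable. The measurable maps $\alpha:G\times X\to H$, $T:G\times X\to X$ and $\beta:H\times Y\to G$, $S:H\times Y\to Y$ are determined (up to null sets) by $$g\cdot x=\alpha(g,x)^{-1}\cdot T^gx,\qquad h\cdot y=\beta(h,y)^{-1}\cdot S^hy ,$$ and integrability means $\int_X|\alpha(g,x)|_H\,dm(x)<\infty$ for all $g\in G$ and $\int_Y|\beta(h,y)|_G\,dm(y)<\infty$ for all $h\in H$, where $|\cdot|_H$, $|\cdot|_G$ are the word lengths of any finite symmetric generating sets. Then $\alpha$ (over $T$ on $(X,m|_X)$) and $\beta$ (over $S$ on $(Y,m|_Y)$) are integrable embeddings. Here a measurable cocycle $\alpha:G\times X\to H$ over a finite-measure-preserving action $T$ of $G$ on $(X,\mu)$ (so $\alpha(g_2g_1,x)=\alpha(g_2,T^{g_1}x)\alpha(g_1,x)$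 for all $g_1,g_2$ and a.e. $x$) is an *integrable embedding* if for every $\epsilon>0$ there is an integrable measurable cocycle $\alpha'$ cohomologous to $\alpha$ (that is, $\alpha'(g,x)=\varphi(T^gx)\alpha(g,x)\varphi(x)^{-1}$ for some measurable $\varphi:X\to H$, for all $g$ and a.e. $x$), a measurable set $X_0\subseteq X$ with $\mu(X_0)>\mu(X)-\epsilon$, and a constant $C>0$, such that for a.e. $x\in X_0$ and every $h\in H$, $$|\{g\in G:\ T^gx\in X_0,\ \alpha'(g,x)=h\}|\le C .$$ Moreover, let $\varphi:X\to H$ be measurable and $C\in\mathbb{N}$ such that for a.e. $x\in X$ the map $g\mapsto\varphi(T^gx)\alpha(g,x)\varphi(x)^{-1}$ is at most $C$-to-one. Then for every $\epsilon>0$ there is a measurable $X_0\subseteq X$ with $m(X_0)>m(X)-\epsilon$ such that, with $\varphi_0=\varphi$ on $X_0$ and $\varphi_0=e_H$ on $X\setminus X_0$, the cocycle $\alpha''(g,x)=\varphi_0(T^gx)\alpha(g,x)\varphi_0(x)^{-1}$ is integrable and for a.e. $x\in X_0$ and every $h\in H$ one has $|\{g\in G: T^gx\in X_0,\ \alpha''(g,x)=h\}|\le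 C$. The same holds for $\beta$, with the roles of $G$ and $H$ exchanged. -/

import Mathlib

open MeasureTheory

namespace IME

/-- `B` is a finite symmetric generating set of the group `H`. -/
def IsSymmGenerating {H : Type*} [Group H] (B : Finset H) : Prop :=
  (∀ b ∈ B, b⁻¹ ∈ B) ∧ Subgroup.closure (B : Set H) = ⊤

/-- The word length of `h` with respect to `B`: the least length of a word in the letters of `B`
which evaluates to `h`. -/
noncomputable def wordLength {H : Type*} [Group H] (B : Finset H) (h : H) : ℕ :=
  sInf {n : ℕ | ∃ l : List H, l.length = n ∧ (∀ b ∈ l, b ∈ B) ∧ l.prod = h}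

/-- `T` is a finite-measure-preserving action of `G` on `(X, μ)`, where, as always in this subject,
the identities of an action are understood up to null sets. -/
structure IsFMPAction {G X : Type*} [Group G] [MeasurableSpace X] (μ : Measure X)
    (T : G → X → X) : Prop where
  finite : μ Set.univ < ⊤
  measurePreserving : ∀ g, MeasurePreserving (T g) μ μ
  one : ∀ᵐ x ∂μ, T 1 x = x
  mul : ∀ g₂ g₁, ∀ᵐ x ∂μ, T (g₂ * g₁) x = T g₂ (T g₁ x)

/-- `α` is a measurable cocycle over `T` with values in the discrete group `H`. The group `G` is
countable and discrete, so measurability of `α` on `G × X` is measurability of every `α g`. -/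
structure IsCocycle {G H X : Type*} [Group G] [Group H] [MeasurableSpace X] (μ : Measure X)
    (T : G → X → X) (α : G → X → H) : Prop where
  measurable : ∀ g, Measurable[inferInstance, ⊤] (α g)
  mul : ∀ g₂ g₁, ∀ᵐ x ∂μ, α (g₂ * g₁) x = α g₂ (T g₁ x) * α g₁ x

/-- The function `(g, x) ↦ φ(T^g x) α(g, x) φ(x)⁻¹`. -/
def twist {G H X : Type*} [Group H] (T : G → X → X) (φ : X → H) (α : G → X → H) : G → X → H :=
  fun g x => φ (T g x) * α g x * (φ x)⁻¹

/-- `α'` is cohomologous to `α`. -/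
def IsCohomologous {G H X : Type*} [Group H] [MeasurableSpace X] (μ : Measure X)
    (T : G → X → X) (α α' : G → X → H) : Prop :=
  ∃ φ : X → H, Measurable[inferInstance, ⊤] φ ∧ ∀ g, ∀ᵐ x ∂μ, α' g x = twist T φ α g x

/-- `α` is integrable: `∫ |α(g, x)|_H dμ(x) < ∞` for all `g`, for every choice of a finite symmetric
generating set of `H`. -/
def IsIntegrableCocycle {G H X : Type*} [Group H] [MeasurableSpace X] (μ : Measure X)
    (α : G → X → H) : Prop :=
  ∀ B : Finset H, IsSymmGenerating B → ∀ g, ∫⁻ x, (wordLength B (α g x) : ENNReal) ∂μ < ⊤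

/-- The return time set `R_Z(x) = {g ∈ G : T^g x ∈ Z}`. -/
def returnTimes {G X : Type*} (T : G → X → X) (Z : Set X) (x : X) : Set G :=
  {g | T g x ∈ Z}

/-- For a.e. `x ∈ Z` and every `h`, at most `C` elements `g` of the return time set `R_Z(x)` satisfy
`α(g, x) = h`. -/
def IsBoundedToOneOn {G H X : Type*} [MeasurableSpace X] (μ : Measure X)
    (T : G → X → X) (Z : Set X) (α : G → X → H) (C : ℕ) : Prop :=
  ∀ᵐ x ∂μ, x ∈ Z → ∀ h, {g ∈ returnTimes T Z x | α g x = h}.encard ≤ C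

/-- `α` is a measurable cocycle over the finite-measure-preserving action `T` which is an integrable
embedding. -/
structure IsIntegrableEmbedding {G H X : Type*} [Group G] [Group H] [MeasurableSpace X]
    (μ : Measure X) (T : G → X → X) (α : G → X → H) : Prop where
  action : IsFMPAction μ T
  cocycle : IsCocycle μ T α
  embedding : ∀ ε : ℝ, 0 < ε → ∃ α' : G → X → H, IsCocycle μ T α' ∧ IsCohomologous μ T α α' ∧
    IsIntegrableCocycle μ α' ∧
    ∃ X₀ : Set X, MeasurableSet X₀ ∧ μ.real Set.univ - ε < μ.real X₀ ∧
      ∃ C : ℕ, 0 < C ∧ IsBoundedToOneOn μ T X₀ α' C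

/-- The restriction of `m` to `X`, as a measure on the subtype `X`. -/
noncomputable def restr {Ω : Type*} [MeasurableSpace Ω] (m : Measure Ω) (X : Set Ω) : Measure X :=
  m.comap (Subtype.val : X → Ω)

/-- `X` is a finite-measure fundamental domain for the action of `H` on `(Ω, m)`. -/
structure IsFiniteFundamentalDomain (H : Type*) {Ω : Type*} [Group H] [MulAction H Ω]
    [MeasurableSpace Ω] (m : Measure Ω) (X : Set Ω) : Prop where
  measurableSet : MeasurableSet X
  isFundamentalDomain : IsFundamentalDomain H X m
  finite : m X < ⊤

/-- `T` and `α` are the action of `G` on the fundamental domain `X` of `H` and the cocycle that the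
coupling `Ω` associates with `X`: they are given by `g • x = α(g, x)⁻¹ • T^g x ∈ α(g, x)⁻¹ • X`.
This determines both up to null sets (and on the nose if the translates of `X` partition `Ω`). -/
structure IsAssociated {G H Ω : Type*} [Group G] [Group H] [MulAction G Ω] [MulAction H Ω]
    [MeasurableSpace Ω] (m : Measure Ω) (X : Set Ω) (T : G → X → X) (α : G → X → H) : Prop where
  measurable_action : ∀ g, Measurable (T g)
  measurable_cocycle : ∀ g, Measurable[inferInstance, ⊤] (α g)
  smul_eq : ∀ g, ∀ᵐ x : X ∂(restr m X), g • (x : Ω) = (α g x)⁻¹ • (T g x : Ω)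

/-- Truncations of the transfer function: whenever a measurable `φ : X → H` makes the cocycle
`φ(T^g x) α(g, x) φ(x)⁻¹` at most `C`-to-one for a.e. `x`, there are sets `X₀` of almost full measure
such that the cocycle given by `φ₀ = φ` on `X₀`, `φ₀ = 1` off `X₀`, is integrable and at most
`C`-to-one on the return time sets of `X₀`. -/
def HasIntegrableTruncations {G H X : Type*} [Group G] [Group H] [MeasurableSpace X]
    (μ : Measure X) (T : G → X → X) (α : G → X → H) : Prop :=
  ∀ φ : X → H, Measurable[inferInstance, ⊤] φ →
    ∀ C : ℕ, (∀ᵐ x ∂μ, ∀ h, {g : G | twist T φ α g x = h}.encard ≤ C) →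
      ∀ ε : ℝ, 0 < ε →
        ∃ X₀ : Set X, MeasurableSet X₀ ∧ μ.real Set.univ - ε < μ.real X₀ ∧
          IsCocycle μ T (twist T (X₀.mulIndicator φ) α) ∧
          IsIntegrableCocycle μ (twist T (X₀.mulIndicator φ) α) ∧
          IsBoundedToOneOn μ T X₀ (twist T (X₀.mulIndicator φ) α) C

end IME

namespace IME

open Filter Set
open scoped ENNReal Topology Pointwise

/-! ### Word length, and sublevel sets of almost everywhere finite functions -/

section WordLength

variable {H : Type*} [Group H] {B : Finset H}

/-! No change of cocycle is needed for the embeddings: `α` itself works. The number of visits of a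
`G`-orbit to `X` has integral `m X < ∞` over the fundamental domain `Y` of `G`, so it is finite a.e.
and at most `n` on a large part `X₀` of `X`. If `α g x = α k x`, then `g * k⁻¹` carries `T k x` to
`T g x` inside `X`; so a fibre of `α` that contains a return time `k` to `X₀` has at most `n`
elements (`IsAssociated.isBoundedToOneOn`). For the truncations, `X₀` is where `φ` stays in a large
finite subset of `H`: bounded factors keep integrability, and on return times to `X₀` the twist is
unchanged. -/

theorem IsSymmGenerating.exists_word (hB : IsSymmGenerating B) (h : H) :
    ∃ l : List H, l.length = wordLength B h ∧ (∀ b ∈ l, b ∈ B) ∧ l.prod = h := by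
  have hne : {n : ℕ | ∃ l : List H, l.length = n ∧ (∀ b ∈ l, b ∈ B) ∧ l.prod = h}.Nonempty := by
    have hmem : h ∈ (Subgroup.closure (B : Set H)).toSubmonoid := by simp [hB.2]
    rw [Subgroup.closure_toSubmonoid] at hmem
    obtain ⟨l, hl, hprod⟩ := Submonoid.exists_list_of_mem_closure hmem
    refine ⟨l.length, l, rfl, fun b hb => ?_, hprod⟩
    rcases hl b hb with h' | h'
    · exact h'
    · simpa using hB.1 _ h'
  exact Nat.sInf_mem hne

theorem wordLength_mul_le (hB : IsSymmGenerating B) (a b : H) :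
    wordLength B (a * b) ≤ wordLength B a + wordLength B b := by
  obtain ⟨k, hk, hkB, hka⟩ := hB.exists_word a
  obtain ⟨l, hl, hlB, hlb⟩ := hB.exists_word b
  refine Nat.sInf_le ⟨k ++ l, by simp [hk, hl], fun c hc => ?_, by simp [hka, hlb]⟩
  rcases List.mem_append.1 hc with h | h
  exacts [hkB c h, hlB c h]

end WordLength

theorem countable_of_fg (G : Type*) [Group G] [Group.FG G] : Countable G := by
  obtain ⟨α, _, φ, hφ⟩ := Group.fg_iff_exists_freeGroup_hom_surjective_finite.1 ‹Group.FG G›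
  exact hφ.countable

/-- A function which is finite almost everywhere is bounded off a set of small measure. -/
theorem exists_measure_le_nat {X : Type*} [MeasurableSpace X] {μ : Measure X} [IsFiniteMeasure μ]
    {f : X → ℝ≥0∞} (hfin : ∀ᵐ x ∂μ, f x < ∞) {ε : ℝ} (hε : 0 < ε) :
    ∃ n : ℕ, μ.real univ - ε < μ.real {x | f x ≤ n} := by
  have hmono : Monotone fun n : ℕ => {x | f x ≤ n} := fun a b hab x hx =>
    le_trans (show f x ≤ a from hx) (by exact_mod_cast hab)
  have hlim := tendsto_measure_iUnion_atTop (μ := μ) hmono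
  have huniv : μ (⋃ n : ℕ, {x | f x ≤ n}) = μ univ := by
    refine measure_congr (eventuallyEq_univ.2 ?_)
    filter_upwards [hfin] with x hx
    obtain ⟨n, hn⟩ := ENNReal.exists_nat_gt hx.ne
    exact mem_iUnion.2 ⟨n, hn.le⟩
  rw [huniv] at hlim
  have hreal := (ENNReal.tendsto_toReal (measure_ne_top μ univ)).comp hlim
  exact (hreal.eventually (lt_mem_nhds (sub_lt_self _ hε))).exists

theorem measurable_twist {G H X : Type*} [Group H] [Countable H] [MeasurableSpace X]
    {T : G → X → X} {φ : X → H} {α : G → X → H} {g : G} (hT : Measurable (T g))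
    (hφ : Measurable[inferInstance, ⊤] φ) (hα : Measurable[inferInstance, ⊤] (α g)) :
    Measurable[inferInstance, ⊤] (twist T φ α g) := by
  let _ : MeasurableSpace H := ⊤
  exact ((hφ.comp hT).mul hα).mul hφ.inv

/-! ### Twisted cocycles and truncated transfer functions -/

section Twist

variable {G H X : Type*} [Group G] [Group H] [MeasurableSpace X]
  {μ : Measure X} {T : G → X → X} {α : G → X → H} {φ : X → H}

theorem IsCocycle.twist [Countable H] (hT : IsFMPAction μ T) (hα : IsCocycle μ T α)
    (hφ : Measurable[inferInstance, ⊤] φ) : IsCocycle μ T (twist T φ α) where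
  measurable g := measurable_twist (hT.measurePreserving g).measurable hφ (hα.measurable g)
  mul g₂ g₁ := by
    filter_upwards [hα.mul g₂ g₁, hT.mul g₂ g₁] with x hx hx'
    simp only [IME.twist, hx, hx']
    group

/-- Twisting by a transfer function with finitely many values preserves integrability. -/
theorem IsIntegrableCocycle.twist (hT : IsFMPAction μ T) (hα : IsIntegrableCocycle μ α)
    {F : Set H} (hF : F.Finite) (hφF : ∀ x, φ x ∈ F) : IsIntegrableCocycle μ (twist T φ α) := by
  intro B hB g
  have : IsFiniteMeasure μ := ⟨hT.finite⟩
  obtain ⟨M, hM⟩ := (hF.image (wordLength B)).bddAbove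
  obtain ⟨N, hN⟩ := (hF.image fun h => wordLength B h⁻¹).bddAbove
  calc ∫⁻ x, (wordLength B (IME.twist T φ α g x) : ℝ≥0∞) ∂μ
      ≤ ∫⁻ x, ((wordLength B (α g x) : ℝ≥0∞) + (M + N : ℕ)) ∂μ := by
        refine lintegral_mono fun x => ?_
        have h₁ := wordLength_mul_le hB (φ (T g x) * α g x) (φ x)⁻¹
        have h₂ := wordLength_mul_le hB (φ (T g x)) (α g x)
        have h₃ : wordLength B (φ (T g x)) ≤ M := hM (mem_image_of_mem _ (hφF _))
        have h₄ : wordLength B (φ x)⁻¹ ≤ N :=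
          hN (mem_image_of_mem (fun h => wordLength B h⁻¹) (hφF x))
        have : wordLength B (IME.twist T φ α g x) ≤ wordLength B (α g x) + (M + N) := by
          simp only [IME.twist]; omega
        refine le_trans (Nat.cast_le.2 this) (Nat.cast_add _ _).le
    _ < ∞ := by
        rw [lintegral_add_right _ measurable_const, lintegral_const]
        exact ENNReal.add_lt_top.2 ⟨hα B hB g,
          ENNReal.mul_lt_top (ENNReal.natCast_lt_top _) (measure_lt_top _ _)⟩

theorem hasIntegrableTruncations [Countable H] (hT : IsFMPAction μ T) (hα : IsCocycle μ T α)
    (hint : IsIntegrableCocycle μ α) : HasIntegrableTruncations μ T α := by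
  intro φ hφ C hC ε hε
  have : IsFiniteMeasure μ := ⟨hT.finite⟩
  -- Sublevel sets of `e` are finite, so bounding `e ∘ φ` confines `φ` to a finite set.
  obtain ⟨e, he⟩ := exists_injective_nat H
  have hmeas : Measurable fun x => (e (φ x) : ℝ≥0∞) :=
    (measurable_from_top (f := fun h : H => (e h : ℝ≥0∞))).comp hφ
  obtain ⟨n, hn⟩ := exists_measure_le_nat (μ := μ)
    (f := fun x => (e (φ x) : ℝ≥0∞)) (Eventually.of_forall fun x => ENNReal.natCast_lt_top _) hε
  set X₀ : Set X := {x | (e (φ x) : ℝ≥0∞) ≤ n} with hX₀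
  have hX₀m : MeasurableSet X₀ := measurableSet_le hmeas measurable_const
  have hφ₀ : Measurable[inferInstance, ⊤] (X₀.mulIndicator φ) := by
    let _ : MeasurableSpace H := ⊤
    exact Measurable.piecewise hX₀m hφ measurable_const
  have hfin : (insert 1 {h : H | e h ≤ n}).Finite :=
    ((finite_Iic n).preimage he.injOn).insert 1
  refine ⟨X₀, hX₀m, hn, hα.twist hT hφ₀, hint.twist hT hfin fun x => ?_, ?_⟩
  · by_cases hx : x ∈ X₀
    · rw [mulIndicator_of_mem hx]
      exact Or.inr (Nat.cast_le.1 (show (e (φ x) : ℝ≥0∞) ≤ n from hx))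
    · rw [mulIndicator_of_notMem hx]
      exact Or.inl rfl
  · filter_upwards [hC] with x hx hxX h
    refine (encard_le_encard fun g hg => ?_).trans (hx h)
    obtain ⟨hg, hgh⟩ := hg
    have hg : T g x ∈ X₀ := hg
    simpa only [IME.twist, mulIndicator_of_mem hxX, mulIndicator_of_mem hg, mem_ofPred_eq] using hgh

end Twist

/-! ### Fundamental domains and orbit counts -/

section Domain

variable {H Ω : Type*} [Group H] [MulAction H Ω] [MeasurableSpace Ω] {m : Measure Ω} {X : Set Ω}

theorem ae_restr_iff (hX : MeasurableSet X) {p : Ω → Prop} :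
    (∀ᵐ x : X ∂restr m X, p x) ↔ ∀ᵐ x ∂m, x ∈ X → p x := by
  rw [← ae_restrict_iff' hX, ← map_comap_subtype_coe hX,
    (MeasurableEmbedding.subtype_coe hX).ae_map_iff]
  rfl

/-- Almost every point is moved into a fundamental domain by at most one group element. -/
theorem IsFiniteFundamentalDomain.ae_unique [Countable H] (hX : IsFiniteFundamentalDomain H m X) :
    ∀ᵐ ω ∂m, ∀ h₁ h₂ : H, h₁ • ω ∈ X → h₂ • ω ∈ X → h₁ = h₂ := by
  refine ae_all_iff.2 fun h₁ => ae_all_iff.2 fun h₂ => ?_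
  by_cases h : h₁ = h₂
  · exact Eventually.of_forall fun _ _ _ => h
  · have := hX.isFundamentalDomain.aedisjoint (fun h' => h (inv_injective h') : h₁⁻¹ ≠ h₂⁻¹)
    filter_upwards [measure_eq_zero_iff_ae_notMem.1 this] with ω hω h₁ω h₂ω
    exact absurd ⟨mem_inv_smul_set_iff.2 h₁ω, mem_inv_smul_set_iff.2 h₂ω⟩ hω

/-- The number of visits of an orbit to a set of finite measure is a measurable function, and is
finite almost everywhere if the action has a fundamental domain. -/
theorem ae_encard_smul_mem_lt_top [Countable H] [MeasurableConstSMul H Ω]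
    [SMulInvariantMeasure H Ω m] {Y : Set Ω} (hY : IsFundamentalDomain H Y m)
    (hX : MeasurableSet X) (hXfin : m X < ∞) :
    Measurable (fun ω => (({h : H | h • ω ∈ X}.encard : ℕ∞) : ℝ≥0∞)) ∧
      ∀ᵐ ω ∂m, (({h : H | h • ω ∈ X}.encard : ℕ∞) : ℝ≥0∞) < ∞ := by
  set N : Ω → ℝ≥0∞ := fun ω => (({h : H | h • ω ∈ X}.encard : ℕ∞) : ℝ≥0∞) with hN
  have hsum : N = fun ω => ∑' h : H, X.indicator 1 (h • ω) := by
    funext ω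
    simp only [hN, ← ENNReal.tsum_set_one]
    rw [tsum_subtype {h : H | h • ω ∈ X} fun _ => (1 : ℝ≥0∞)]
    rfl
  have hmeas : ∀ h : H, Measurable fun ω : Ω => X.indicator (1 : Ω → ℝ≥0∞) (h • ω) := fun h =>
    (measurable_one.indicator hX).comp (measurable_const_smul h)
  have hNm : Measurable N := hsum ▸ Measurable.tsum hmeas
  -- Unfolding: the translates of `Y` tile the space.
  have hint : ∫⁻ ω in Y, N ω ∂m = m X := by
    rw [hsum, lintegral_tsum fun h => (hmeas h).aemeasurable,
      ← hY.lintegral_eq_tsum'' (X.indicator 1), lintegral_indicator_one hX]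
  have hinv : ∀ (h : H) ω, N (h • ω) = N ω := fun h ω => by
    rw [hsum]
    simp only [smul_smul]
    exact (Equiv.mulRight h).tsum_eq fun k => X.indicator (1 : Ω → ℝ≥0∞) (k • ω)
  refine ⟨hNm, ?_⟩
  have hset : MeasurableSet {ω | N ω = ∞} := hNm (measurableSet_singleton _)
  have hzero : m {ω | N ω = ∞} = 0 := by
    -- An invariant set that is null in `Y` is null.
    refine hY.measure_zero_of_invariant _ (fun h => ?_) ?_
    · ext ω
      simp [mem_smul_set_iff_inv_smul_mem, hinv]
    · have := ae_lt_top hNm (hint ▸ hXfin.ne)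
      rw [ae_iff] at this
      rwa [← Measure.restrict_apply hset, show {ω | N ω = ∞} = {ω | ¬ N ω < ∞} by ext; simp]
  filter_upwards [measure_eq_zero_iff_ae_notMem.1 hzero] with ω hω
  exact lt_top_iff_ne_top.2 hω

end Domain

/-! ### The action and cocycle associated with a coupling -/

section Coupling

variable {G H Ω : Type*} [Group G] [Group H] [MulAction G Ω] [MulAction H Ω]
  [MeasurableSpace Ω] {m : Measure Ω} {X : Set Ω} {T : G → X → X} {α : G → X → H}

theorem IsAssociated.ae_smul_eq (hα : IsAssociated m X T α) (g : G) :
    ∀ᵐ x : X ∂restr m X, α g x • g • (x : Ω) = T g x := by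
  filter_upwards [hα.smul_eq g] with x hx
  rw [hx, smul_inv_smul]

/-- On the points of `X` whose `G`-orbit meets `X` at most `n` times, the associated cocycle is at
most `n`-to-one. -/
theorem IsAssociated.isBoundedToOneOn [Countable G] [SMulCommClass G H Ω]
    (hα : IsAssociated m X T α) (n : ℕ) :
    IsBoundedToOneOn (restr m X) T {x : X | {g : G | g • (x : Ω) ∈ X}.encard ≤ n} α n := by
  filter_upwards [ae_all_iff.2 hα.ae_smul_eq] with x hx _ h
  rcases eq_empty_or_nonempty
      {g ∈ returnTimes T {x : X | {g : G | g • (x : Ω) ∈ X}.encard ≤ n} x | α g x = h}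
    with h₀ | ⟨k, hk, hkh⟩
  · simp [h₀]
  have hk : {g : G | g • (T k x : Ω) ∈ X}.encard ≤ n := hk
  refine le_trans ?_ hk
  have hinj : Function.Injective fun g : G => g * k⁻¹ := mul_left_injective k⁻¹
  rw [← hinj.encard_image]
  refine encard_le_encard ?_
  rintro _ ⟨g, ⟨-, rfl⟩, rfl⟩
  have : (g * k⁻¹) • (T k x : Ω) = T g x := by
    rw [← hx k, hkh, ← hx g, smul_comm (g * k⁻¹) (α g x), smul_smul (g * k⁻¹),
      inv_mul_cancel_right]
  exact (mem_of_eq_of_mem this (T g x).2 : (g * k⁻¹) • (T k x : Ω) ∈ X)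

variable [Countable H] [MeasurableConstSMul G Ω] [SMulInvariantMeasure G Ω m]

theorem IsFiniteFundamentalDomain.ae_unique_smul (hX : IsFiniteFundamentalDomain H m X) (g : G) :
    ∀ᵐ x : X ∂restr m X, ∀ h₁ h₂ : H, h₁ • g • (x : Ω) ∈ X → h₂ • g • (x : Ω) ∈ X → h₁ = h₂ :=
  (ae_restr_iff hX.measurableSet).2 <|
    ((measurePreserving_smul g m).quasiMeasurePreserving.ae hX.ae_unique).mono fun _ h _ => h

variable [SMulCommClass G H Ω] [MeasurableConstSMul H Ω] [SMulInvariantMeasure H Ω m]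

/-- Both `X` and `g • X` are fundamental domains for `H`, since the actions commute; hence an
`H`-invariant set meets them in equal measure. This is applied to the `H`-saturation `E` of `A`. -/
theorem IsAssociated.measurePreserving (hX : IsFiniteFundamentalDomain H m X)
    (hα : IsAssociated m X T α) (g : G) : MeasurePreserving (T g) (restr m X) (restr m X) := by
  refine ⟨hα.measurable_action g, Measure.ext fun A hA => ?_⟩
  rw [Measure.map_apply (hα.measurable_action g) hA]
  have hA' : MeasurableSet (Subtype.val '' A : Set Ω) := hX.measurableSet.subtype_image hA
  have hAX : (Subtype.val '' A : Set Ω) ⊆ X := by rintro _ ⟨a, -, rfl⟩; exact a.2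
  set E : Set Ω := ⋃ h : H, (fun ω => h • ω) ⁻¹' (Subtype.val '' A) with hE
  have hEm : MeasurableSet E :=
    MeasurableSet.iUnion fun h => measurable_const_smul h hA'
  have hEinv : ∀ k : H, (fun ω => k • ω) ⁻¹' E = E := fun k => by
    ext ω
    simp only [hE, mem_preimage, mem_iUnion, smul_smul]
    exact ((Equiv.mulRight k).surjective.exists
      (p := fun i => i • ω ∈ (Subtype.val '' A : Set Ω))).symm
  have hval : ∀ (D : Set X) (D' : Set Ω), MeasurableSet D' →
      (∀ᵐ x : X ∂restr m X, x ∈ D ↔ (x : Ω) ∈ D') → restr m X D = m (D' ∩ X) := by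
    intro D D' hD' h
    rw [measure_congr (show D =ᵐ[restr m X] Subtype.val ⁻¹' D' from h.mono fun x hx => propext hx),
      restr, comap_subtype_coe_apply hX.measurableSet, Subtype.image_preimage_coe, inter_comm]
  rw [hval A E hEm, hval (T g ⁻¹' A) ((fun ω => g • ω) ⁻¹' E) (measurable_const_smul g hEm)]
  · rw [hX.isFundamentalDomain.measure_set_eq (hX.isFundamentalDomain.smul_of_comm g) hEm hEinv,
      ← measure_preimage_smul m g (E ∩ g • X), preimage_inter, preimage_smul g (g • X),
      inv_smul_smul]
  · filter_upwards [hX.ae_unique_smul g, hα.ae_smul_eq g] with x hx hgx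
    refine ⟨fun h => mem_iUnion.2 ⟨α g x, T g x, h, hgx.symm⟩, fun h => ?_⟩
    obtain ⟨k, hk⟩ := mem_iUnion.1 h
    have hk : k • g • (x : Ω) ∈ (Subtype.val '' A : Set Ω) := hk
    -- Only `α g x` brings `g • x` back to `X`.
    obtain rfl := hx k (α g x) (hAX hk) (hgx ▸ (T g x).2)
    rw [hgx] at hk
    simpa using hk
  · filter_upwards [(ae_restr_iff hX.measurableSet).2 (hX.ae_unique.mono fun _ h _ => h)] with x hx
    refine ⟨fun h => mem_iUnion.2 ⟨1, x, h, (one_smul _ _).symm⟩, fun h => ?_⟩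
    obtain ⟨k, hk⟩ := mem_iUnion.1 h
    have hk : k • (x : Ω) ∈ (Subtype.val '' A : Set Ω) := hk
    obtain rfl := hx k 1 (hAX hk) (by simp)
    simpa using hk

theorem IsAssociated.ae_mul (hX : IsFiniteFundamentalDomain H m X) (hα : IsAssociated m X T α)
    (g₂ g₁ : G) : ∀ᵐ x : X ∂restr m X,
      T (g₂ * g₁) x = T g₂ (T g₁ x) ∧ α (g₂ * g₁) x = α g₂ (T g₁ x) * α g₁ x := by
  filter_upwards [hX.ae_unique_smul (g₂ * g₁), hα.ae_smul_eq (g₂ * g₁), hα.ae_smul_eq g₁,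
    (hα.measurePreserving hX g₁).quasiMeasurePreserving.ae (hα.ae_smul_eq g₂)] with x hx h₂₁ h₁ h₂
  have h : (α g₂ (T g₁ x) * α g₁ x) • (g₂ * g₁) • (x : Ω) = T g₂ (T g₁ x) := by
    rw [← h₂, ← h₁, mul_smul, mul_smul, smul_comm g₂ (α g₁ x)]
  -- Both elements carry `(g₂ * g₁) • x` into `X`, so they agree.
  have hcoc := hx _ _ (h₂₁ ▸ (T (g₂ * g₁) x).2) (h ▸ (T g₂ (T g₁ x)).2)
  refine ⟨Subtype.ext ?_, hcoc⟩
  rw [← h, ← h₂₁, hcoc]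

theorem IsAssociated.isFMPAction (hX : IsFiniteFundamentalDomain H m X)
    (hα : IsAssociated m X T α) : IsFMPAction (restr m X) T where
  finite := by
    rw [restr, comap_subtype_coe_apply hX.measurableSet]
    simpa using hX.finite
  measurePreserving := hα.measurePreserving hX
  one := by
    filter_upwards [hX.ae_unique_smul (1 : G), hα.ae_smul_eq 1] with x hx h
    have h₁ := hx _ 1 (h ▸ (T 1 x).2) (by simp)
    exact Subtype.ext (by rw [← h, h₁]; simp)
  mul g₂ g₁ := (hα.ae_mul hX g₂ g₁).mono fun _ h => h.1

theorem IsAssociated.isCocycle (hX : IsFiniteFundamentalDomain H m X)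
    (hα : IsAssociated m X T α) : IsCocycle (restr m X) T α where
  measurable := hα.measurable_cocycle
  mul g₂ g₁ := (hα.ae_mul hX g₂ g₁).mono fun _ h => h.2

theorem IsAssociated.isIntegrableEmbedding [Countable G] {Y : Set Ω}
    (hX : IsFiniteFundamentalDomain H m X) (hY : IsFundamentalDomain G Y m)
    (hα : IsAssociated m X T α) (hint : IsIntegrableCocycle (restr m X) α) :
    IsIntegrableEmbedding (restr m X) T α where
  action := hα.isFMPAction hX
  cocycle := hα.isCocycle hX
  embedding ε hε := by
    have : IsFiniteMeasure (restr m X) := ⟨(hα.isFMPAction hX).finite⟩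
    obtain ⟨hmeas, hfin⟩ := ae_encard_smul_mem_lt_top hY hX.measurableSet hX.finite
    have hmeas' := hmeas.comp (measurable_subtype_coe (p := (· ∈ X)))
    obtain ⟨n, hn⟩ := exists_measure_le_nat (μ := restr m X)
      ((ae_restr_iff hX.measurableSet).2 (hfin.mono fun _ h _ => h)) hε
    have hset : {x : X | {g : G | g • (x : Ω) ∈ X}.encard ≤ n} =
        {x : X | (({g : G | g • (x : Ω) ∈ X}.encard : ℕ∞) : ℝ≥0∞) ≤ n} := by
      ext x
      exact_mod_cast Iff.rfl
    -- The transfer function is trivial; `n + 1` serves as the constant because `n` may be zero.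
    refine ⟨α, hα.isCocycle hX, ⟨fun _ => 1, measurable_const, fun g => ?_⟩, hint,
      {x : X | {g : G | g • (x : Ω) ∈ X}.encard ≤ n}, ?_, ?_, n + 1, n.succ_pos, ?_⟩
    · exact Eventually.of_forall fun x => by simp [twist]
    · rw [hset]
      exact measurableSet_le hmeas' measurable_const
    · rw [hset]
      exact hn
    · filter_upwards [hα.isBoundedToOneOn n] with x hx hxX h
      exact (hx hxX h).trans (by exact_mod_cast n.le_succ)

end Coupling

end IME

theorem theoremB9 {G H Ω : Type*} [Group G] [Group H] [Group.FG G] [Group.FG H]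
    [MulAction G Ω] [MulAction H Ω] [SMulCommClass G H Ω] [MeasurableSpace Ω]
    [MeasurableConstSMul G Ω] [MeasurableConstSMul H Ω]
    (m : Measure Ω) [SigmaFinite m] [NeZero m]
    [SMulInvariantMeasure G Ω m] [SMulInvariantMeasure H Ω m]
    (X Y : Set Ω)
    (hX : IME.IsFiniteFundamentalDomain H m X) (hY : IME.IsFiniteFundamentalDomain G m Y)
    (T : G → X → X) (α : G → X → H) (hα : IME.IsAssociated m X T α)
    (S : H → Y → Y) (β : H → Y → G) (hβ : IME.IsAssociated m Y S β)
    (hαint : IME.IsIntegrableCocycle (IME.restr m X) α)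
    (hβint : IME.IsIntegrableCocycle (IME.restr m Y) β) :
    (IME.IsIntegrableEmbedding (IME.restr m X) T α ∧
      IME.IsIntegrableEmbedding (IME.restr m Y) S β) ∧
    (IME.HasIntegrableTruncations (IME.restr m X) T α ∧
      IME.HasIntegrableTruncations (IME.restr m Y) S β) := by
  have : Countable G := IME.countable_of_fg G
  have : Countable H := IME.countable_of_fg H
  have : SMulCommClass H G Ω := SMulCommClass.symm G H Ω
  exact ⟨⟨hα.isIntegrableEmbedding hX hY.isFundamentalDomain hαint,
      hβ.isIntegrableEmbedding hY hX.isFundamentalDomain hβint⟩,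
    IME.hasIntegrableTruncations (hα.isFMPAction hX) (hα.isCocycle hX) hαint,
    IME.hasIntegrableTruncations (hβ.isFMPAction hY) (hβ.isCocycle hY) hβint⟩
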